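/- Let $n\ge 0$ be an integer, let $V=\mathbb{C}\text{-span}\{v_0,v_1\}$, and for $S\subseteq\{1,\dots,n\}$ let $v_S=v_{i_1}\otimes\cdots\otimes v_{i_n}\in V^{\otimes n}$, where $i_k=1$ if $k\in S$ and $i_k=0$ otherwise. Equip $V^{\otimes n}$ with the inner product $$\langle v_S,v_{S'}\rangle_\pi=\frac{1}{n+1}\,\frac{1}{\binom{n}{|S|}}\,\delta_{S,S'}.$$ Let the symmetric group $S_n$ act on $V^{\otimes n}$ by $w\,v_S=v_{wS}$, let $s_{ir}$ be the transposition of $i$ and $r$, let $s_j=s_{j,j+1}$, and let $M_r=\sum_{i=1}^{r-1}s_{ir}$ be the Jucys–Murphy operators on $V^{\otimes n}$ (so $M_1=0$). For $1\le j\le n-1$ put $\tau_j=s_j+(M_j-M_{j+1})^{-1}$, the operator $M_j-M_{j+1}$ being invertible on $V^{\otimes n}$. Let $0\le m\le\lfloor n/2\rfloor$ and $0\le \ell\le n-2m$. For $0\le i\le n-2m$ define $$T_{m,n}^{(\ell)}(i)=\sum_{\substack{S\subseteq\{1,\dots,n-2m\}\\ |S|=\ell}}(-1)^{m+|S\cap\{1,\dots,i\}|}\binom{2m+\ell}{m+|S\cap\{1,\dots,i\}|},$$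 $$g_T^{m,i}=(v_0\otimes v_1-v_1\otimes v_0)^{\otimes m}\otimes\sum_{\substack{S\subseteq\{1,\dots,n-2m\}\\ |S|=i}}v_S,\qquad f_T^{m,\ell}=\sum_{i=0}^{n-2m}T_{m,n}^{(\ell)}(i)\,g_T^{m,i},$$ where $v_S\in V^{\otimes(n-2m)}$ in the sum defining $g_T^{m,i}$. Let $Q$ be a standard Young tableau of shape $(n-m,m)$ with second row $a_1<\cdots<a_m$ (so $a_r\ge 2r$ for all $r$), and define $$\tau_Q=\tau_Q^{(1)}\cdots\tau_Q^{(m)},\qquad \tau_Q^{(r)}=\tau_{a_r-1}\cdots\tau_{2r+1}\tau_{2r},\qquad f_Q^{m,\ell}=\tau_Q f_T^{m,\ell},\qquad \gamma_Q=\prod_{r=1}^{m}\ \prod_{k=2}^{a_r-2r+1}\frac{k^2-1}{k^2},$$ where empty products are equal to $1$ (in particular $\tau_Q^{(r)}=1$ if $a_r=2r$). Then $$\langle f_Q^{m,\ell},f_Q^{m,\ell}\rangle_\pi=\gamma_Q\,\frac{2^m}{n+1}\cdot\frac{(2m+\ell)!}{(2m+2\ell+1)\,(m+\ell)!^2\,\ell!}\cdot\frac{(n-2m)!}{n!}\cdot\frac{(n+\ell+1)!}{(n-2m-\ell)!}.$$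 -/

import Mathlib

namespace TwoRowBasis

noncomputable section

/-- A standard Young tableau of shape `μ`: a filling of the cells of `μ` by the numbers
`1, …, |μ|`, each used exactly once, increasing along rows and down columns.
Cell `(x, y)` is in row `x` and column `y`, both counted from `0`. -/
structure StandardYoungTableau (μ : YoungDiagram) extends SemistandardYoungTableau μ where
  bijOn : Set.BijOn (fun c : ℕ × ℕ => entry c.1 c.2) (μ.cells : Set (ℕ × ℕ)) (Set.Icc 1 μ.card)

lemma sortedGE_pair {n m : ℕ} (h : 2 * m ≤ n) : [n - m, m].SortedGE := by
  rw [List.sortedGE_iff_pairwise]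
  simp
  omega

/-- The two-row shape `(n - m, m)`. -/
def shape (n m : ℕ) (h : 2 * m ≤ n) : YoungDiagram :=
  YoungDiagram.ofRowLens [n - m, m] (sortedGE_pair h)

/-- The entry `a_r` of the second row of the tableau, `r = 1, 2, …`. -/
def StandardYoungTableau.a {μ : YoungDiagram} (Q : StandardYoungTableau μ) (r : ℕ) : ℕ :=
  Q.entry 1 (r - 1)

/-- The space `V^{⊗ n}` for `V = span_ℂ {v_0, v_1}`, viewed as the space of complex functions on
the set of subsets of the `n` positions (equivalently on binary `n`-tuples). Positions `1, …, n`
are represented by `Fin n`, position `k` being the element of `Fin n` with value `k - 1`. -/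
abbrev Space (n : ℕ) : Type := Finset (Fin n) → ℂ

/-- The basis vector `v_S`. -/
def v {n : ℕ} (S : Finset (Fin n)) : Space n := Pi.single S 1

/-- The inner product with `⟨v_S, v_T⟩ = δ_{ST} / ((n + 1) * (n choose |S|))`. -/
def innerPi {n : ℕ} (f g : Space n) : ℂ :=
  ∑ S : Finset (Fin n), starRingEnd ℂ (f S) * g S / ((n + 1) * n.choose S.card)

/-- The action of a permutation `w` of the positions, `w v_S = v_{w S}` (see `perm_v`). -/
def perm {n : ℕ} (w : Equiv.Perm (Fin n)) : Module.End ℂ (Space n) :=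
  LinearMap.funLeft ℂ ℂ fun S : Finset (Fin n) => S.map w.symm.toEmbedding

lemma perm_apply {n : ℕ} (w : Equiv.Perm (Fin n)) (f : Space n) (S : Finset (Fin n)) :
    perm w f S = f (S.map w.symm.toEmbedding) := rfl

lemma perm_v {n : ℕ} (w : Equiv.Perm (Fin n)) (S : Finset (Fin n)) :
    perm w (v S) = v (S.map w.toEmbedding) := by
  funext T
  have h : T.map w.symm.toEmbedding = S ↔ T = S.map w.toEmbedding := by
    constructor
    · rintro rfl
      ext x
      simp
    · rintro rfl
      ext x
      simp
  simp only [perm_apply, v, Pi.single_apply, h]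

/-- The Jucys-Murphy element `M_r`, the sum of the transpositions `(i r)` over `i < r`. -/
def jucysMurphy {n : ℕ} (r : Fin n) : Module.End ℂ (Space n) :=
  ∑ i ∈ Finset.Iio r, perm (Equiv.swap i r)

lemma perm_mul {n : ℕ} (w u : Equiv.Perm (Fin n)) : perm (w * u) = perm w * perm u := by
  ext f S
  simp only [Module.End.mul_apply, LinearMap.comp_apply, perm_apply, Finset.map_map]
  congr 1

lemma dot_perm {n : ℕ} (w : Equiv.Perm (Fin n)) (hw : w.symm = w) (f g : Space n) :
    star f ⬝ᵥ perm w g = star (perm w f) ⬝ᵥ g := by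
  refine Fintype.sum_equiv (Equiv.finsetCongr w) _ _ fun S => ?_
  have : (S.map w.toEmbedding).map w.symm.toEmbedding = S := by
    ext x
    simp
  simp only [Pi.star_apply, perm_apply, Equiv.finsetCongr_apply, this]
  rw [hw]

lemma dot_jucysMurphy {n : ℕ} (r : Fin n) (f g : Space n) :
    star f ⬝ᵥ jucysMurphy r g = star (jucysMurphy r f) ⬝ᵥ g := by
  simp only [jucysMurphy, LinearMap.sum_apply, star_sum, dotProduct_sum, sum_dotProduct]
  exact Finset.sum_congr rfl fun i _ => dot_perm _ (Equiv.symm_swap _ _) f g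

open scoped ComplexOrder in
/-- `M_j - M_{j+1}` is invertible, so that its `Ring.inverse` is a genuine inverse. -/
lemma isUnit_jucysMurphy_sub {n : ℕ} (p q : Fin n) (hpq : q.val = p.val + 1) :
    IsUnit (jucysMurphy p - jucysMurphy q) := by
  have hne : p ≠ q := by
    rintro rfl
    omega
  have hI : Finset.Iio q = insert p (Finset.Iio p) := by
    ext x
    simp only [Finset.mem_Iio, Finset.mem_insert, Fin.lt_def, Fin.ext_iff]
    omega
  have hss : perm (Equiv.swap p q) * perm (Equiv.swap p q) = 1 := by
    rw [← perm_mul, Equiv.swap_mul_self]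
    refine LinearMap.ext fun f => funext fun S => ?_
    rw [perm_apply, Module.End.one_apply]
    congr 1
    ext x
    simp
  have hrel : perm (Equiv.swap p q) * jucysMurphy q
      = 1 + jucysMurphy p * perm (Equiv.swap p q) := by
    rw [jucysMurphy, hI, Finset.sum_insert (by simp), mul_add, hss, jucysMurphy,
      Finset.mul_sum, Finset.sum_mul]
    congr 1
    refine Finset.sum_congr rfl fun i hi => ?_
    have hip : i ≠ p := (Finset.mem_Iio.1 hi).ne
    have hiq : i ≠ q := by
      rintro rfl
      have := Fin.lt_def.1 (Finset.mem_Iio.1 hi)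
      omega
    rw [← perm_mul, ← perm_mul]
    congr 1
    rw [Equiv.mul_swap_eq_swap_mul, Equiv.swap_apply_right, Equiv.swap_apply_of_ne_of_ne hip hiq]
  rw [LinearMap.isUnit_iff_ker_eq_bot, LinearMap.ker_eq_bot']
  intro f hf
  have hf' : jucysMurphy q f = jucysMurphy p f := by
    rw [LinearMap.sub_apply, sub_eq_zero] at hf
    exact hf.symm
  have h1 : perm (Equiv.swap p q) (jucysMurphy p f)
      = f + jucysMurphy p (perm (Equiv.swap p q) f) := by
    rw [← hf']
    exact LinearMap.congr_fun hrel f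
  have h2 : star f ⬝ᵥ perm (Equiv.swap p q) (jucysMurphy p f)
      = star f ⬝ᵥ f + star f ⬝ᵥ jucysMurphy p (perm (Equiv.swap p q) f) := by
    rw [h1, dotProduct_add]
  have h3 : star (star f ⬝ᵥ jucysMurphy p (perm (Equiv.swap p q) f))
      = star f ⬝ᵥ perm (Equiv.swap p q) (jucysMurphy p f) := by
    rw [dot_perm _ (Equiv.symm_swap _ _), dot_jucysMurphy, Matrix.star_dotProduct, star_star,
      dotProduct_comm]
  have h4 : star (star f ⬝ᵥ f) = star f ⬝ᵥ f :=
    (Matrix.star_dotProduct f f).symm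
  rw [← h3] at h2
  have h5 : star f ⬝ᵥ f = 0 := by
    have h6 := congrArg star h2
    rw [star_add, star_star, h4] at h6
    linear_combination (-1 / 2 : ℂ) * h2 - (1 / 2 : ℂ) * h6
  exact dotProduct_star_self_eq_zero.1 h5

/-- The operator `τ_j = s_j + (M_j - M_{j+1})⁻¹` for `1 ≤ j ≤ n - 1`. -/
def tau (n j : ℕ) : Module.End ℂ (Space n) :=
  if h : 1 ≤ j ∧ j < n then
    perm (Equiv.swap (⟨j - 1, by omega⟩ : Fin n) ⟨j, h.2⟩)
      + Ring.inverse (jucysMurphy (⟨j - 1, by omega⟩ : Fin n) - jucysMurphy ⟨j, h.2⟩)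
  else 1

/-- The product `τ_{a-1} ⋯ τ_{2r+1} τ_{2r}`, which is `1` if `a = 2r`. -/
def tauRow (n r a : ℕ) : Module.End ℂ (Space n) :=
  ((List.range' (2 * r) (a - 2 * r)).reverse.map (tau n)).prod

/-- The operator `τ_Q = τ_Q^{(1)} ⋯ τ_Q^{(m)}`. -/
def tauTableau {n m : ℕ} {h : 2 * m ≤ n} (Q : StandardYoungTableau (shape n m h)) :
    Module.End ℂ (Space n) :=
  ((List.range' 1 m).map fun r => tauRow n r (Q.a r)).prod

/-- The scalar `T_{m,n}^{(ℓ)}(i)`. -/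
def scalarT (m n ℓ i : ℕ) : ℂ :=
  ∑ S ∈ (Finset.Icc 1 (n - 2 * m)).powersetCard ℓ,
    (-1) ^ (m + (S ∩ Finset.Icc 1 i).card) * (2 * m + ℓ).choose (m + (S ∩ Finset.Icc 1 i).card)

/-- The coefficient of `v_b ⊗ v_c` in `v_{01} - v_{10}`, where `b` is the proposition that
the first factor is `v_1` and `c` that the second one is. -/
def pairCoeff (b c : Prop) [Decidable b] [Decidable c] : ℂ :=
  (if ¬b ∧ c then 1 else 0) - (if b ∧ ¬c then 1 else 0)

/-- The vector `g_T^{m,i} = (v_{01} - v_{10})^{⊗ m} ⊗ ∑_S v_S`, the sum being over all sets `S`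
of `i` of the last `n - 2m` positions. Its value at a subset `S` of the positions is the product of
the coefficients of the factors: one for each pair of positions `(2r - 1, 2r)`, `r = 1, …, m`, and
one for the positions beyond `2m`. -/
def gColumn (n m i : ℕ) : Space n := fun S =>
  (∏ r ∈ Finset.Icc 1 m, pairCoeff (∃ k ∈ S, k.val + 1 = 2 * r - 1) (∃ k ∈ S, k.val + 1 = 2 * r))
    * if (S.filter fun k => 2 * m < k.val + 1).card = i then 1 else 0

/-- The vector `f_T^{m,ℓ} = ∑_i T_{m,n}^{(ℓ)}(i) g_T^{m,i}`, for the column reading tableau. -/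
def fColumn (n m ℓ : ℕ) : Space n :=
  ∑ i ∈ Finset.range (n - 2 * m + 1), scalarT m n ℓ i • gColumn n m i

/-- The vector `f_Q^{m,ℓ} = τ_Q f_T^{m,ℓ}`. -/
def fTableau {n m : ℕ} {h : 2 * m ≤ n} (Q : StandardYoungTableau (shape n m h)) (ℓ : ℕ) :
    Space n :=
  tauTableau Q (fColumn n m ℓ)

/-- The scalar `γ_Q = ∏_r ∏_{k=2}^{a_r - 2r + 1} (k² - 1) / k²`. -/
def gammaTableau {n m : ℕ} {h : 2 * m ≤ n} (Q : StandardYoungTableau (shape n m h)) : ℝ :=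
  ∏ r ∈ Finset.Icc 1 m, ∏ k ∈ Finset.Icc 2 (Q.a r - 2 * r + 1), ((k : ℝ) ^ 2 - 1) / (k : ℝ) ^ 2

end

end TwoRowBasis

/-! The formula splits into the factor `γ_Q`, produced by the operators `τ_j`, and the squared norm
of the column vector `f_T`.

For `γ_Q`: the weight of `v_S` depends only on `|S|`, so permutations are unitary and the
Jucys–Murphy operators are self-adjoint. If `f` is a joint eigenvector with eigenvalues (contents)
`c`, and `c j ≠ c (j + 1)`, then `τ_j f` is a joint eigenvector with these two contents exchanged.
It is therefore orthogonal to `f`, which forces its squared norm to be `1 - 1 / (c j - c (j + 1))²`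
times that of `f` (`HasContents.innerPi_tau`). The vector `f_T` has the contents of the column
reading tableau (`hasContents_fColumn`). The factor `τ_Q^{(r)}` moves a box of content `r - 2` past
boxes of contents `r, r + 1, …`; the differences `2, 3, …, a_r - 2r + 1` give `γ_Q`
(`exists_hasContents_tauRows`).

For `f_T`: the `m` singlets contribute `2 ^ m` and put `m` elements into `S`. What remains is a
weighted sum of `T(i)²` (`innerPi_fColumn`). Here `T` is a symmetric Hahn polynomial, and its
product with the weight is an `ℓ`-fold difference. Summation by parts `ℓ` times reduces `T` to a
constant, leaving a Vandermonde-type binomial sum (`sum_hahnPoly_mul_hahnDual`, `sum_hahnPoly_sq`).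
-/

namespace TwoRowBasis
open Finset

/-! ### Hahn polynomials and discrete summation by parts. -/

section Hahn
variable {R : Type*} [CommRing R]

/-- The discrete polynomial `∑ c_k (x choose k) (N - x choose ℓ - k)` in `x`. -/
def hahnPoly (c : ℕ → R) (N ℓ x : ℕ) : R :=
  ∑ p ∈ antidiagonal ℓ, c p.1 * x.choose p.1 * (N - x).choose p.2

/-- The product of the degree `r` Hahn polynomial with its weight, up to a constant. -/
def hahnDual (R : Type*) [CommRing R] (m N r x : ℕ) : R :=
  ∑ p ∈ antidiagonal r,
    r.choose p.1 * ((-1) ^ p.1 * (m + x).choose (m + p.1) * (m + N - x).choose (m + p.2))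

/-- Pascal's rule in `x` at the left point and in `N - x` at the right point: the difference in `x`
lowers the degree and differences the coefficient sequence. -/
lemma hahnPoly_succ_sub (c : ℕ → R) {N x : ℕ} (ℓ : ℕ) (hx : x ≤ N) :
    hahnPoly c (N + 1) (ℓ + 1) (x + 1) - hahnPoly c (N + 1) (ℓ + 1) x
      = hahnPoly (fun k => c (k + 1) - c k) N ℓ x := by
  have h1 : hahnPoly c (N + 1) (ℓ + 1) (x + 1)
      = (∑ p ∈ antidiagonal (ℓ + 1), c p.1 * x.choose p.1 * (N - x).choose p.2)
        + ∑ p ∈ antidiagonal ℓ, c (p.1 + 1) * x.choose p.1 * (N - x).choose p.2 := by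
    rw [hahnPoly, Nat.sum_antidiagonal_succ, Nat.sum_antidiagonal_succ, add_assoc,
      ← sum_add_distrib]
    congr 1
    · simp
    · refine sum_congr rfl fun p _ => ?_
      simp only [Nat.choose_succ_succ, Nat.add_sub_add_right]
      push_cast
      ring
  have h2 : hahnPoly c (N + 1) (ℓ + 1) x
      = (∑ p ∈ antidiagonal (ℓ + 1), c p.1 * x.choose p.1 * (N - x).choose p.2)
        + ∑ p ∈ antidiagonal ℓ, c p.1 * x.choose p.1 * (N - x).choose p.2 := by
    rw [hahnPoly, Nat.sum_antidiagonal_succ', Nat.sum_antidiagonal_succ', add_assoc,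
      ← sum_add_distrib]
    congr 1
    · simp
    · refine sum_congr rfl fun p _ => ?_
      simp only [Nat.succ_sub hx, Nat.succ_eq_add_one, Nat.choose_succ_succ]
      push_cast
      ring
  rw [h1, h2, add_sub_add_left_eq_sub, ← sum_sub_distrib]
  exact sum_congr rfl fun p _ => by ring

/-- Pascal's rule for `(r + 1).choose` pairs the terms. In this form `hahnDual` at `(m, N + 1, r +
1)` is the backward difference of `hahnDual` at `(m + 1, N, r)`; the case `x = 0` is separate
because there the value at `-1` counts as zero. -/
lemma hahnDual_succ (m N r x : ℕ) :
    hahnDual R m (N + 1) (r + 1) x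
      = ∑ p ∈ antidiagonal r, r.choose p.1 * ((-1 : R) ^ p.1
        * ((m + x).choose (m + p.1) * (m + (N + 1) - x).choose (m + p.2 + 1)
          - (m + x).choose (m + p.1 + 1) * (m + (N + 1) - x).choose (m + p.2))) := by
  rw [hahnDual, sum_antidiagonal_choose_succ_mul
    (fun i j => (-1) ^ i * ((m + x).choose (m + i) : R) * (m + (N + 1) - x).choose (m + j)),
    ← sum_add_distrib]
  refine sum_congr rfl fun p hp => ?_
  rw [← Nat.choose_symm_of_eq_add (mem_antidiagonal.1 hp).symm]
  simp only [← add_assoc]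
  ring

lemma hahnDual_succ_zero (m N r : ℕ) :
    hahnDual R m (N + 1) (r + 1) 0 = hahnDual R (m + 1) N r 0 := by
  rw [hahnDual_succ, hahnDual]
  refine sum_congr rfl fun p _ => ?_
  have e1 : m + (N + 1) - 0 = m + 1 + N - 0 := by omega
  have e2 : m + 1 + p.1 = m + p.1 + 1 := by omega
  have e3 : m + 1 + p.2 = m + p.2 + 1 := by omega
  rw [e1, e2, e3, add_zero, add_zero, Nat.choose_succ_succ m, Nat.choose_eq_zero_of_lt
    (show m < m + p.1 + 1 by omega)]
  push_cast
  ring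

lemma hahnDual_succ_succ (m r : ℕ) {N x : ℕ} (hx : x ≤ N) :
    hahnDual R m (N + 1) (r + 1) (x + 1)
      = hahnDual R (m + 1) N r (x + 1) - hahnDual R (m + 1) N r x := by
  rw [hahnDual_succ, hahnDual, hahnDual, ← sum_sub_distrib]
  refine sum_congr rfl fun p _ => ?_
  have e0 : m + 1 + (x + 1) = m + (x + 1) + 1 := by omega
  have e0' : m + 1 + x = m + (x + 1) := by omega
  have e1 : m + (N + 1) - (x + 1) = m + N - x := by omega
  have e1' : m + 1 + N - (x + 1) = m + N - x := by omega
  have e1'' : m + 1 + N - x = m + N - x + 1 := by omega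
  have e2 : m + 1 + p.1 = m + p.1 + 1 := by omega
  have e3 : m + 1 + p.2 = m + p.2 + 1 := by omega
  rw [e0, e0', e1, e1', e1'', e2, e3, Nat.choose_succ_succ (m + (x + 1)),
    Nat.choose_succ_succ (m + N - x)]
  push_cast
  ring

lemma hahnDual_top (m N r : ℕ) : hahnDual R (m + 1) N r (N + 1) = 0 := by
  refine sum_eq_zero fun p _ => ?_
  rw [Nat.choose_eq_zero_of_lt (show m + 1 + N - (N + 1) < m + 1 + p.2 by omega)]
  simp

/-- Summation by parts against `hahnDual`. -/
lemma sum_mul_hahnDual_succ (f : ℕ → R) (m N r : ℕ) :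
    ∑ x ∈ range (N + 2), f x * hahnDual R m (N + 1) (r + 1) x
      = -∑ x ∈ range (N + 1), (f (x + 1) - f x) * hahnDual R (m + 1) N r x := by
  -- The boundary term at `N + 1` vanishes; the one at `0` is absorbed by `hahnDual_succ_zero`.
  have h : ∑ x ∈ range (N + 2), f x * hahnDual R (m + 1) N r x
      = ∑ x ∈ range (N + 1), f x * hahnDual R (m + 1) N r x := by
    rw [sum_range_succ, hahnDual_top, mul_zero, add_zero]
  rw [sum_range_succ'] at h ⊢
  rw [hahnDual_succ_zero]
  have h' : ∑ x ∈ range (N + 1), f (x + 1) * hahnDual R m (N + 1) (r + 1) (x + 1)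
      = ∑ x ∈ range (N + 1), (f (x + 1) * hahnDual R (m + 1) N r (x + 1)
        - f (x + 1) * hahnDual R (m + 1) N r x) :=
    sum_congr rfl fun x hx => by
      rw [hahnDual_succ_succ m r (Nat.lt_succ_iff.1 (mem_range.1 hx))]
      ring
  rw [h', sum_sub_distrib]
  simp only [sub_mul, sum_sub_distrib]
  rw [← h]
  ring

/-- Coefficient of `X ^ N` in `(1 - X)^{-(a+1)} (1 - X)^{-(a+1)} = (1 - X)^{-(2a+2)}`. -/
lemma sum_choose_mul_choose (a N : ℕ) :
    ∑ x ∈ range (N + 1), (a + x).choose a * (a + N - x).choose a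
      = (2 * a + N + 1).choose (2 * a + 1) := by
  have h : (PowerSeries.mk 1 ^ (a + 1) * PowerSeries.mk 1 ^ (a + 1) : PowerSeries ℤ)
      = PowerSeries.mk 1 ^ (2 * a + 1 + 1) := by
    rw [← pow_add]
    congr 1
    ring
  rw [PowerSeries.mk_one_pow_eq_mk_choose_add, PowerSeries.mk_one_pow_eq_mk_choose_add] at h
  have h2 := congrArg (PowerSeries.coeff N) h
  rw [PowerSeries.coeff_mul, PowerSeries.coeff_mk, Nat.sum_antidiagonal_eq_sum_range_succ_mk] at h2
  simp only [PowerSeries.coeff_mk] at h2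
  have e : 2 * a + N + 1 = 2 * a + 1 + N := by omega
  rw [e]
  zify
  rw [← h2]
  refine sum_congr rfl fun x hx => ?_
  rw [Nat.add_sub_assoc (Nat.lt_succ_iff.1 (mem_range.1 hx))]

/-- The sequence of signed binomial coefficients `(-1)^(m+k) (M choose m + k)`. -/
def signedChoose (R : Type*) [CommRing R] (M m k : ℕ) : R := (-1) ^ (m + k) * M.choose (m + k)

lemma signedChoose_sub (M m k : ℕ) :
    signedChoose R M m (k + 1) - signedChoose R M m k = signedChoose R (M + 1) (m + 1) k := by
  have e : m + 1 + k = m + k + 1 := by omega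
  rw [signedChoose, signedChoose, signedChoose, e, Nat.choose_succ_succ, ← add_assoc]
  push_cast
  ring

/-- Each summation by parts lowers `r` by one, raises `M` and `m` by one, since differencing
preserves the family `signedChoose`, and costs a sign. At `r = 0` the polynomial is constant. -/
lemma sum_hahnPoly_mul_hahnDual (r : ℕ) : ∀ M m N : ℕ,
    ∑ x ∈ range (N + r + 1), hahnPoly (signedChoose R M m) (N + r) r x * hahnDual R m (N + r) r x
      = (-1) ^ m * (M + r).choose (m + r) * (2 * (m + r) + N + 1).choose (2 * (m + r) + 1) := by
  induction r with
  | zero =>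
    intro M m N
    have h : ∀ x, hahnPoly (signedChoose R M m) (N + 0) 0 x * hahnDual R m (N + 0) 0 x
        = (-1) ^ m * (M + 0).choose (m + 0)
          * (((m + x).choose m * (m + N - x).choose m : ℕ) : R) := by
      intro x
      simp [hahnPoly, hahnDual, signedChoose]
    simp only [h, ← mul_sum, ← Nat.cast_sum]
    rw [add_zero, sum_choose_mul_choose, add_zero]
  | succ r ih =>
    intro M m N
    rw [← add_assoc N, sum_mul_hahnDual_succ]
    have h : ∀ x ∈ range (N + r + 1),
        (hahnPoly (signedChoose R M m) (N + r + 1) (r + 1) (x + 1)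
          - hahnPoly (signedChoose R M m) (N + r + 1) (r + 1) x) * hahnDual R (m + 1) (N + r) r x
        = hahnPoly (signedChoose R (M + 1) (m + 1)) (N + r) r x * hahnDual R (m + 1) (N + r) r x :=
      fun x hx => by
        rw [hahnPoly_succ_sub _ _ (Nat.lt_succ_iff.1 (mem_range.1 hx))]
        simp only [signedChoose_sub]
    rw [sum_congr rfl h, ih]
    have e1 : m + 1 + r = m + (r + 1) := by omega
    have e2 : M + 1 + r = M + (r + 1) := by omega
    rw [e1, e2]
    ring

end Hahn

/-! ### The norm of the symmetric Hahn polynomial and its identification with `scalarT`. -/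

lemma hahn_term {i k ℓ j m N : ℕ} (hi : i ≤ N) (hkj : k + j = ℓ) :
    ((m + i).factorial * (m + N - i).factorial * ℓ.factorial : ℂ)
        * (i.choose k * (N - i).choose j * (2 * m + ℓ).choose (m + k))
      = i.factorial * (N - i).factorial * (2 * m + ℓ).factorial
        * (ℓ.choose k * (m + i).choose (m + k) * (m + N - i).choose (m + j)) := by
  -- When `k` or `j` is too large both sides vanish; otherwise all the binomials are quotients of
  -- factorials.
  rcases lt_or_ge i k with h | h
  · rw [Nat.choose_eq_zero_of_lt h, Nat.choose_eq_zero_of_lt (show m + i < m + k by omega)]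
    simp
  rcases lt_or_ge (N - i) j with h' | h'
  · rw [Nat.choose_eq_zero_of_lt h', Nat.choose_eq_zero_of_lt (show m + N - i < m + j by omega)]
    simp
  rw [Nat.cast_choose ℂ h, Nat.cast_choose ℂ h', Nat.cast_choose ℂ (show k ≤ ℓ by omega),
    Nat.cast_choose ℂ (show m + k ≤ m + i by omega),
    Nat.cast_choose ℂ (show m + j ≤ m + N - i by omega),
    Nat.cast_choose ℂ (show m + k ≤ 2 * m + ℓ by omega)]
  have e1 : 2 * m + ℓ - (m + k) = m + j := by omega
  have e2 : ℓ - k = j := by omega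
  have e3 : m + i - (m + k) = i - k := by omega
  have e4 : m + N - i - (m + j) = N - i - j := by omega
  rw [e1, e2, e3, e4]
  have := fun t : ℕ => (Nat.cast_ne_zero (R := ℂ)).2 t.factorial_ne_zero
  have h1 := this k
  have h2 := this j
  have h3 := this (i - k)
  have h4 := this (N - i - j)
  have h5 := this (m + k)
  have h6 := this (m + j)
  field_simp

/-- A discrete Rodrigues formula: for `M = 2m + ℓ` the weight turns the Hahn polynomial into the
iterated difference `hahnDual`. -/
lemma hahnPoly_mul_weight {i ℓ m N : ℕ} (hi : i ≤ N) :
    ((m + i).factorial * (m + N - i).factorial * ℓ.factorial : ℂ)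
        * hahnPoly (signedChoose ℂ (2 * m + ℓ) m) N ℓ i
      = i.factorial * (N - i).factorial * (2 * m + ℓ).factorial
        * ((-1) ^ m * hahnDual ℂ m N ℓ i) := by
  rw [hahnPoly, hahnDual, mul_sum, mul_sum, mul_sum]
  refine sum_congr rfl fun p hp => ?_
  have h := hahn_term (m := m) hi (mem_antidiagonal.1 hp)
  rw [signedChoose]
  rw [pow_add]
  linear_combination (-1) ^ m * (-1) ^ p.1 * h

/-- The squared norm of the symmetric Hahn polynomial of degree `ℓ`. -/
lemma sum_hahnPoly_sq {ℓ m N : ℕ} (hℓ : ℓ ≤ N) :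
    ∑ i ∈ range (N + 1), hahnPoly (signedChoose ℂ (2 * m + ℓ) m) N ℓ i ^ 2
        * (N.choose i / (N + 2 * m).choose (m + i))
      = (2 * m + ℓ).factorial / ((2 * m + 2 * ℓ + 1) * (m + ℓ).factorial ^ 2 * ℓ.factorial)
        * (N.factorial / (N + 2 * m).factorial)
        * ((N + 2 * m + ℓ + 1).factorial / (N - ℓ).factorial) := by
  have hf := fun t : ℕ => (Nat.cast_ne_zero (R := ℂ)).2 t.factorial_ne_zero
  -- The weight is absorbed into one of the two factors of the square.
  have h1 : ∀ i ∈ range (N + 1), hahnPoly (signedChoose ℂ (2 * m + ℓ) m) N ℓ i ^ 2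
        * (N.choose i / (N + 2 * m).choose (m + i) : ℂ)
      = ((2 * m + ℓ).factorial * (-1) ^ m * N.factorial
          / (ℓ.factorial * (N + 2 * m).factorial) : ℂ)
        * (hahnPoly (signedChoose ℂ (2 * m + ℓ) m) N ℓ i * hahnDual ℂ m N ℓ i) := by
    intro i hi
    have hi' : i ≤ N := Nat.lt_succ_iff.1 (mem_range.1 hi)
    have h := hahnPoly_mul_weight (ℓ := ℓ) (m := m) hi'
    rw [Nat.cast_choose ℂ hi', Nat.cast_choose ℂ (show m + i ≤ N + 2 * m by omega)]
    have e : N + 2 * m - (m + i) = m + N - i := by omega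
    rw [e]
    have a1 := hf i
    have a2 := hf (N - i)
    have a3 := hf ℓ
    have a4 := hf (N + 2 * m)
    have a5 := hf (m + i)
    have a6 := hf (m + N - i)
    have a7 := hf N
    field_simp
    linear_combination hahnPoly (signedChoose ℂ (2 * m + ℓ) m) N ℓ i * h
  rw [sum_congr rfl h1, ← mul_sum]
  obtain ⟨N, rfl⟩ := Nat.exists_eq_add_of_le' hℓ
  rw [sum_hahnPoly_mul_hahnDual, Nat.cast_choose ℂ (show m + ℓ ≤ 2 * m + ℓ + ℓ by omega),
    Nat.cast_choose ℂ (show 2 * (m + ℓ) + 1 ≤ 2 * (m + ℓ) + N + 1 by omega)]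
  have e1 : 2 * m + ℓ + ℓ - (m + ℓ) = m + ℓ := by omega
  have e2 : 2 * m + ℓ + ℓ = 2 * (m + ℓ) := by omega
  have e3 : 2 * (m + ℓ) + N + 1 - (2 * (m + ℓ) + 1) = N := by omega
  have e4 : N + ℓ + 2 * m + ℓ + 1 = 2 * (m + ℓ) + N + 1 := by omega
  rw [e1, e2, e3, e4, Nat.add_sub_cancel, Nat.factorial_succ (2 * (m + ℓ))]
  have a1 := hf (m + ℓ)
  have a2 := hf (2 * (m + ℓ))
  have a3 := hf ℓ
  have a4 := hf (N + ℓ + 2 * m)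
  have a5 := hf N
  have a6 : (2 * (m : ℂ) + 2 * ℓ + 1) ≠ 0 := by exact_mod_cast Nat.succ_ne_zero (2 * m + 2 * ℓ)
  have a7 : (2 * ((m : ℂ) + ℓ) + 1) ≠ 0 := by rwa [mul_add]
  push_cast
  have e : ((-1 : ℂ) ^ m) ^ 2 = 1 := by rw [← pow_mul, mul_comm, pow_mul]; simp
  field_simp
  rw [e]
  ring

/-- Subsets are counted by the size of their part in `A`; adding an element to `B` is Pascal's rule
for `B.card`. -/
lemma sum_powersetCard_union {α M : Type*} [DecidableEq α] [CommRing M] (g : ℕ → M)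
    (A B : Finset α) (hAB : Disjoint A B) (ℓ : ℕ) :
    ∑ S ∈ (A ∪ B).powersetCard ℓ, g (S ∩ A).card
      = ∑ p ∈ antidiagonal ℓ, g p.1 * A.card.choose p.1 * B.card.choose p.2 := by
  induction B using Finset.induction_on generalizing ℓ with
  | empty =>
    rw [union_empty, sum_congr rfl (g := fun _ => g ℓ) fun S hS => by
      rw [inter_eq_left.2 (mem_powersetCard.1 hS).1, (mem_powersetCard.1 hS).2]]
    rw [sum_const, card_powersetCard, nsmul_eq_mul]
    cases ℓ with
    | zero => simp
    | succ ℓ => rw [Nat.sum_antidiagonal_succ']; simp [mul_comm]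
  | insert b B hb ih =>
    rw [disjoint_insert_right] at hAB
    cases ℓ with
    | zero => simp
    | succ ℓ =>
      have hb' : b ∉ A ∪ B := by simp [hb, hAB.1]
      rw [union_insert, powersetCard_succ_insert hb', sum_union, ih hAB.2, sum_image]
      · rw [sum_congr rfl (g := fun S => g (S ∩ A).card) fun S _ => by
          rw [insert_inter_of_notMem hAB.1], ih hAB.2, card_insert_of_notMem hb,
          Nat.sum_antidiagonal_succ', Nat.sum_antidiagonal_succ', add_assoc, ← sum_add_distrib]
        congr 1
        · simp
        · refine sum_congr rfl fun p _ => ?_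
          rw [Nat.choose_succ_succ]
          push_cast
          ring
      · intro S hS T hT hST
        have h1 : b ∉ S := fun h => hb' ((mem_powersetCard.1 hS).1 h)
        have h2 : b ∉ T := fun h => hb' ((mem_powersetCard.1 hT).1 h)
        rw [← erase_insert h1, ← erase_insert h2]
        exact congrArg (fun U => U.erase b) hST
      · rw [disjoint_left]
        intro S hS hS'
        obtain ⟨T, _, rfl⟩ := mem_image.1 hS'
        exact hb' ((mem_powersetCard.1 hS).1 (mem_insert_self _ _))

lemma scalarT_eq {m n ℓ i : ℕ} (hi : i ≤ n - 2 * m) :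
    scalarT m n ℓ i = hahnPoly (signedChoose ℂ (2 * m + ℓ) m) (n - 2 * m) ℓ i := by
  have h : Icc 1 (n - 2 * m) = Icc 1 i ∪ Icc (i + 1) (n - 2 * m) := by
    ext x
    simp only [mem_Icc, mem_union]
    omega
  have hd : Disjoint (Icc 1 i) (Icc (i + 1) (n - 2 * m)) := by
    rw [disjoint_left]
    intro x
    simp only [mem_Icc]
    omega
  rw [scalarT, h]
  refine (sum_powersetCard_union (signedChoose ℂ (2 * m + ℓ) m) _ _ hd ℓ).trans ?_
  rw [hahnPoly, Nat.card_Icc, Nat.card_Icc]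
  congr! 4
  omega

lemma scalarT_conj (m n ℓ i : ℕ) : starRingEnd ℂ (scalarT m n ℓ i) = scalarT m n ℓ i := by
  simp [scalarT]


/-! ### Jucys–Murphy operators, joint eigenvectors and the operators `τ_j`. -/

section Inner
variable {n : ℕ}

lemma innerPi_add_left (f g h : Space n) : innerPi (f + g) h = innerPi f h + innerPi g h := by
  simp only [innerPi, ← sum_add_distrib]
  exact sum_congr rfl fun S _ => by simp only [Pi.add_apply, map_add]; ring

lemma innerPi_add_right (f g h : Space n) : innerPi f (g + h) = innerPi f g + innerPi f h := by
  simp only [innerPi, ← sum_add_distrib]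
  exact sum_congr rfl fun S _ => by simp only [Pi.add_apply]; ring

lemma innerPi_smul_left (a : ℂ) (f g : Space n) :
    innerPi (a • f) g = starRingEnd ℂ a * innerPi f g := by
  simp only [innerPi, mul_sum]
  exact sum_congr rfl fun S _ => by simp only [Pi.smul_apply, smul_eq_mul, map_mul]; ring

lemma innerPi_smul_right (a : ℂ) (f g : Space n) : innerPi f (a • g) = a * innerPi f g := by
  simp only [innerPi, mul_sum]
  exact sum_congr rfl fun S _ => by simp only [Pi.smul_apply, smul_eq_mul]; ring

lemma innerPi_zero_left (f : Space n) : innerPi 0 f = 0 := by simp [innerPi]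

lemma innerPi_zero_right (f : Space n) : innerPi f 0 = 0 := by simp [innerPi]

lemma innerPi_sum_left {ι : Type*} (s : Finset ι) (F : ι → Space n) (g : Space n) :
    innerPi (∑ i ∈ s, F i) g = ∑ i ∈ s, innerPi (F i) g := by
  classical
  induction s using Finset.induction_on with
  | empty => simp [innerPi_zero_left]
  | insert a s ha ih => rw [sum_insert ha, sum_insert ha, innerPi_add_left, ih]

lemma innerPi_sum_right {ι : Type*} (s : Finset ι) (F : ι → Space n) (g : Space n) :
    innerPi g (∑ i ∈ s, F i) = ∑ i ∈ s, innerPi g (F i) := by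
  classical
  induction s using Finset.induction_on with
  | empty => simp [innerPi_zero_right]
  | insert a s ha ih => rw [sum_insert ha, sum_insert ha, innerPi_add_right, ih]

lemma innerPi_perm (w : Equiv.Perm (Fin n)) (f g : Space n) :
    innerPi (perm w f) (perm w g) = innerPi f g := by
  refine Fintype.sum_equiv (Equiv.finsetCongr w.symm) _ _ fun S => ?_
  simp only [perm_apply, Equiv.finsetCongr_apply, card_map]

lemma perm_swap_mul_self (p q : Fin n) : perm (Equiv.swap p q) * perm (Equiv.swap p q) = 1 := by
  rw [← perm_mul, Equiv.swap_mul_self]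
  refine LinearMap.ext fun f => funext fun S => ?_
  rw [perm_apply, Module.End.one_apply]
  congr 1
  ext x
  simp

lemma perm_swap_perm_swap (p q : Fin n) (f : Space n) :
    perm (Equiv.swap p q) (perm (Equiv.swap p q) f) = f :=
  LinearMap.congr_fun (perm_swap_mul_self p q) f

/-- Transpositions are unitary involutions, hence self-adjoint. -/
lemma innerPi_jucysMurphy (r : Fin n) (f g : Space n) :
    innerPi f (jucysMurphy r g) = innerPi (jucysMurphy r f) g := by
  simp only [jucysMurphy, LinearMap.sum_apply, innerPi_sum_left, innerPi_sum_right]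
  refine sum_congr rfl fun i _ => ?_
  rw [← innerPi_perm (Equiv.swap i r), perm_swap_perm_swap]

lemma swap_mul_jucysMurphy {p q : Fin n} (hpq : q.val = p.val + 1) :
    perm (Equiv.swap p q) * jucysMurphy q = 1 + jucysMurphy p * perm (Equiv.swap p q) := by
  have hI : Iio q = insert p (Iio p) := by
    ext x
    simp only [mem_Iio, mem_insert, Fin.lt_def, Fin.ext_iff]
    omega
  rw [jucysMurphy, hI, sum_insert (by simp), mul_add, perm_swap_mul_self, jucysMurphy,
    mul_sum, sum_mul]
  congr 1
  refine sum_congr rfl fun i hi => ?_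
  have hip : i ≠ p := (mem_Iio.1 hi).ne
  have hiq : i ≠ q := by
    rintro rfl
    have := Fin.lt_def.1 (mem_Iio.1 hi)
    omega
  rw [← perm_mul, ← perm_mul]
  congr 1
  rw [Equiv.mul_swap_eq_swap_mul, Equiv.swap_apply_right, Equiv.swap_apply_of_ne_of_ne hip hiq]

lemma jucysMurphy_mul_swap {p q : Fin n} (hpq : q.val = p.val + 1) :
    jucysMurphy q * perm (Equiv.swap p q) = 1 + perm (Equiv.swap p q) * jucysMurphy p := by
  have h := congrArg (fun x => perm (Equiv.swap p q) * x * perm (Equiv.swap p q))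
    (swap_mul_jucysMurphy hpq)
  simp only [mul_add, add_mul, mul_one, ← mul_assoc, perm_swap_mul_self, one_mul] at h
  rw [h, mul_assoc, perm_swap_mul_self, mul_one]

lemma swap_mul_jucysMurphy_of_ne {p q r : Fin n} (hpq : q.val = p.val + 1) (hp : r ≠ p)
    (hq : r ≠ q) :
    perm (Equiv.swap p q) * jucysMurphy r = jucysMurphy r * perm (Equiv.swap p q) := by
  rw [jucysMurphy, mul_sum, sum_mul]
  refine sum_equiv (Equiv.swap p q) (fun i => ?_) fun i _ => ?_
  · rw [mem_Iio, mem_Iio, Equiv.swap_apply_def, Fin.lt_def, Fin.lt_def]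
    have h1 := Fin.val_ne_of_ne hp
    have h2 := Fin.val_ne_of_ne hq
    split_ifs with h h
    · subst h
      omega
    · subst h
      omega
    · rfl
  · rw [← perm_mul, ← perm_mul, Equiv.mul_swap_eq_swap_mul, Equiv.swap_apply_of_ne_of_ne hp hq]

/-- `f` is a joint eigenvector of the Jucys-Murphy operators, with the eigenvalue `c k` at the
position `k = 1, …, n`. -/
def HasContents (f : Space n) (c : ℕ → ℤ) : Prop :=
  ∀ r : Fin n, jucysMurphy r f = (c (r.val + 1) : ℂ) • f

lemma HasContents.smul {f : Space n} {c : ℕ → ℤ} (hf : HasContents f c) (a : ℂ) :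
    HasContents (a • f) c := fun r => by
  rw [map_smul, hf r, smul_comm]

lemma HasContents.sum {ι : Type*} {s : Finset ι} {F : ι → Space n} {c : ℕ → ℤ}
    (hF : ∀ i ∈ s, HasContents (F i) c) : HasContents (∑ i ∈ s, F i) c := fun r => by
  rw [map_sum, smul_sum]
  exact sum_congr rfl fun i hi => hF i hi r

lemma HasContents.innerPi_eq_zero {f g : Space n} {c d : ℕ → ℤ} (hf : HasContents f c)
    (hg : HasContents g d) {j : ℕ} (hj : 1 ≤ j) (hjn : j ≤ n) (h : c j ≠ d j) :
    innerPi f g = 0 := by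
  obtain ⟨j, rfl⟩ := Nat.exists_eq_add_of_le' hj
  have h1 := innerPi_jucysMurphy ⟨j, hjn⟩ f g
  rw [hf, hg, innerPi_smul_left, innerPi_smul_right] at h1
  rw [map_intCast] at h1
  have h2 : ((d (j + 1) : ℂ) - c (j + 1)) * innerPi f g = 0 := by
    rw [sub_mul, sub_eq_zero]
    exact h1
  refine (mul_eq_zero.1 h2).resolve_left (sub_ne_zero.2 ?_)
  exact_mod_cast h.symm

section Tau
variable {f : Space n} {c : ℕ → ℤ} {j : ℕ}

lemma HasContents.tau_apply (hf : HasContents f c) (hj : 1 ≤ j) (hjn : j < n)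
    (hc : c j ≠ c (j + 1)) :
    tau n j f = perm (Equiv.swap (⟨j - 1, by omega⟩ : Fin n) ⟨j, hjn⟩) f
      + ((c j : ℂ) - c (j + 1))⁻¹ • f := by
  have hne : (c j : ℂ) - c (j + 1) ≠ 0 := by
    rw [sub_ne_zero]
    exact_mod_cast hc
  have hu := isUnit_jucysMurphy_sub (⟨j - 1, by omega⟩ : Fin n) ⟨j, hjn⟩ (by simp; omega)
  rw [tau, dif_pos ⟨hj, hjn⟩, LinearMap.add_apply]
  congr 1
  have h1 : (jucysMurphy (⟨j - 1, by omega⟩ : Fin n) - jucysMurphy ⟨j, hjn⟩) f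
      = ((c j : ℂ) - c (j + 1)) • f := by
    rw [LinearMap.sub_apply, hf, hf, ← sub_smul]
    simp only [Nat.sub_add_cancel hj]
  have h2 := LinearMap.congr_fun (Ring.inverse_mul_cancel _ hu) f
  rw [Module.End.mul_apply, h1, map_smul, Module.End.one_apply] at h2
  rw [← h2, smul_smul, inv_mul_cancel₀ hne, one_smul, h2]

/-- By `s M_{j+1} = 1 + M_j s`, the vector `s f` is an eigenvector of `M_j` up to a multiple of `f`;
the added term `(c j - c (j + 1))⁻¹ f` removes exactly this defect. -/
lemma HasContents.tau (hf : HasContents f c) (hj : 1 ≤ j) (hjn : j < n)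
    (hc : c j ≠ c (j + 1)) :
    HasContents (tau n j f) (c ∘ Equiv.swap j (j + 1)) := by
  have hne : (c j : ℂ) - c (j + 1) ≠ 0 := by
    rw [sub_ne_zero]
    exact_mod_cast hc
  obtain ⟨j, rfl⟩ := Nat.exists_eq_add_of_le' hj
  rw [hf.tau_apply hj hjn hc]
  simp only [Nat.add_sub_cancel]
  have hjn' : j < n := by omega
  set p : Fin n := ⟨j, hjn'⟩ with hp
  set q : Fin n := ⟨j + 1, hjn⟩ with hq
  have hpq : q.val = p.val + 1 := rfl
  intro r
  rw [map_add, map_smul, hf r]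
  rcases eq_or_ne r p with rfl | hrp
  · have h := LinearMap.congr_fun (swap_mul_jucysMurphy hpq) f
    rw [Module.End.mul_apply, LinearMap.add_apply, Module.End.mul_apply, Module.End.one_apply,
      hf q, map_smul] at h
    have h' : jucysMurphy p (perm (Equiv.swap p q) f)
        = (c (q.val + 1) : ℂ) • perm (Equiv.swap p q) f - f := by
      rw [h]
      abel
    rw [h']
    have e : (c ∘ Equiv.swap (j + 1) (j + 1 + 1)) (p.val + 1) = c (j + 1 + 1) := by simp [hp]
    rw [e]
    have e2 : (c (p.val + 1) : ℂ) = c (j + 1) := rfl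
    have e3 : (c (q.val + 1) : ℂ) = c (j + 1 + 1) := rfl
    rw [e2, e3]
    ext S
    simp only [Pi.add_apply, Pi.sub_apply, Pi.smul_apply, smul_eq_mul]
    field_simp
    ring
  rcases eq_or_ne r q with rfl | hrq
  · have h := LinearMap.congr_fun (jucysMurphy_mul_swap hpq) f
    rw [Module.End.mul_apply, LinearMap.add_apply, Module.End.mul_apply, Module.End.one_apply,
      hf p, map_smul] at h
    rw [h]
    have e : (c ∘ Equiv.swap (j + 1) (j + 1 + 1)) (q.val + 1) = c (j + 1) := by simp [hq]
    rw [e]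
    have e2 : (c (p.val + 1) : ℂ) = c (j + 1) := rfl
    have e3 : (c (q.val + 1) : ℂ) = c (j + 1 + 1) := rfl
    rw [e2, e3]
    ext S
    simp only [Pi.add_apply, Pi.smul_apply, smul_eq_mul]
    field_simp
    ring
  · have h := LinearMap.congr_fun (swap_mul_jucysMurphy_of_ne hpq hrp hrq) f
    rw [Module.End.mul_apply, Module.End.mul_apply, hf r, map_smul] at h
    have h1 : r.val ≠ j := fun h => hrp (Fin.ext h)
    have h2 : r.val ≠ j + 1 := fun h => hrq (Fin.ext h)
    have e : (c ∘ Equiv.swap (j + 1) (j + 1 + 1)) (r.val + 1) = c (r.val + 1) := by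
      rw [Function.comp_apply, Equiv.swap_apply_of_ne_of_ne] <;> omega
    rw [← h, e, smul_add, smul_comm]

/-- Write `τ f = s f + d f` with `d` real. Orthogonality of `τ f` and `f` gives `⟨s f, f⟩ = -d ⟨f,
f⟩`, so `⟨τ f, τ f⟩ = ⟨s f, τ f⟩ = ⟨f, f⟩ + d ⟨s f, f⟩ = (1 - d²) ⟨f, f⟩`. -/
lemma HasContents.innerPi_tau (hf : HasContents f c) (hj : 1 ≤ j) (hjn : j < n)
    (hc : c j ≠ c (j + 1)) :
    innerPi (TwoRowBasis.tau n j f) (TwoRowBasis.tau n j f)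
      = (1 - 1 / ((c j : ℂ) - c (j + 1)) ^ 2) * innerPi f f := by
  have hne : (c j : ℂ) - c (j + 1) ≠ 0 := by
    rw [sub_ne_zero]
    exact_mod_cast hc
  have hh := hf.tau hj hjn hc
  have hc' : c j ≠ (c ∘ Equiv.swap j (j + 1)) j := by simpa using hc
  have h1 := hf.innerPi_eq_zero hh hj hjn.le hc'
  have h2 := hh.innerPi_eq_zero hf hj hjn.le hc'.symm
  have h3 := hf.tau_apply hj hjn hc
  set h := TwoRowBasis.tau n j f
  set w := Equiv.swap (⟨j - 1, by omega⟩ : Fin n) ⟨j, hjn⟩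
  have hd : starRingEnd ℂ ((c j : ℂ) - c (j + 1))⁻¹ = ((c j : ℂ) - c (j + 1))⁻¹ := by simp
  have h4 : innerPi h h = innerPi (perm w f) h := by
    rw [show innerPi h h = innerPi (perm w f + _) h from congrArg (innerPi · h) h3,
      innerPi_add_left, innerPi_smul_left, h1, mul_zero, add_zero]
  have h5 : innerPi (perm w f) h
      = innerPi f f + ((c j : ℂ) - c (j + 1))⁻¹ * innerPi (perm w f) f := by
    rw [h3, innerPi_add_right, innerPi_smul_right, innerPi_perm]
  rw [h3, innerPi_add_left, innerPi_smul_left, hd] at h2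
  rw [h4, h5, one_div, ← inv_pow]
  linear_combination ((c j : ℂ) - c (j + 1))⁻¹ * h2

end Tau

/-- Moving the box at position `p` past `k` boxes of contents `c p + 2, …, c p + k + 1`. -/
lemma HasContents.tau_prod {f : Space n} {c : ℕ → ℤ} (hf : HasContents f c) {p : ℕ} (hp : 1 ≤ p) :
    ∀ k : ℕ, p + k ≤ n → (∀ i < k, c (p + i + 1) = c p + 2 + i) →
    ∃ c' : ℕ → ℤ, HasContents (((List.range' p k).reverse.map (TwoRowBasis.tau n)).prod f) c'
      ∧ (∀ x < p, c' x = c x) ∧ (∀ i < k, c' (p + i) = c (p + i + 1)) ∧ c' (p + k) = c p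
      ∧ (∀ x, p + k < x → c' x = c x)
      ∧ innerPi (((List.range' p k).reverse.map (TwoRowBasis.tau n)).prod f)
          (((List.range' p k).reverse.map (TwoRowBasis.tau n)).prod f)
        = (∏ i ∈ Icc 2 (k + 1), ((i : ℂ) ^ 2 - 1) / (i : ℂ) ^ 2) * innerPi f f := by
  intro k
  induction k with
  | zero =>
    intro _ _
    exact ⟨c, by simpa using hf, by simp, by simp, by simp, by simp, by simp⟩
  | succ k ih =>
    intro hk hc
    obtain ⟨c', h1, h2, h3, h4, h5, h6⟩ := ih (by omega) fun i hi => hc i (by omega)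
    have e : ((List.range' p (k + 1)).reverse.map (TwoRowBasis.tau n)).prod f
        = TwoRowBasis.tau n (p + k)
          (((List.range' p k).reverse.map (TwoRowBasis.tau n)).prod f) := by
      rw [List.range'_1_concat, List.reverse_append]
      simp
    have h7 : c' (p + k + 1) = c p + 2 + k := by
      rw [h5 _ (by omega)]
      exact hc k (by omega)
    have hne : c' (p + k) ≠ c' (p + k + 1) := by
      rw [h4, h7]
      omega
    rw [e]
    refine ⟨_, h1.tau (by omega) (by omega) hne, fun x hx => ?_, fun i hi => ?_, ?_,
      fun x hx => ?_, ?_⟩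
    · rw [Function.comp_apply, Equiv.swap_apply_of_ne_of_ne (by omega) (by omega), h2 x hx]
    · rcases Nat.lt_succ_iff_lt_or_eq.1 hi with hi | rfl
      · rw [Function.comp_apply, Equiv.swap_apply_of_ne_of_ne (by omega) (by omega), h3 i hi]
      · rw [Function.comp_apply, Equiv.swap_apply_left, h5 _ (by omega)]
    · rw [Function.comp_apply, ← add_assoc, Equiv.swap_apply_right, h4]
    · rw [Function.comp_apply, Equiv.swap_apply_of_ne_of_ne (by omega) (by omega), h5 x (by omega)]
    -- The content difference is `-(k + 2)`, so the new factor `1 - 1 / (k + 2)²` is the one with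
    -- index `k + 2`.
    · rw [h1.innerPi_tau (by omega) (by omega) hne, h6, h7, h4,
        ← Finset.insert_Icc_right_eq_Icc_add_one (show 2 ≤ k + 1 + 1 by omega), prod_insert (by simp)]
      have : (k : ℂ) + 2 ≠ 0 := by exact_mod_cast Nat.succ_ne_zero (k + 1)
      have e2 : (c p : ℂ) - ((c p + 2 + k : ℤ) : ℂ) = -((k : ℂ) + 2) := by push_cast; ring
      rw [e2]
      push_cast
      have e3 : (k : ℂ) + 1 + 1 = k + 2 := by ring
      rw [e3]
      field_simp

end Inner

/-! ### Contents of the column vector. -/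

section Column
variable {n : ℕ}

lemma map_swap_of_iff {a b : Fin n} {S : Finset (Fin n)} (h : a ∈ S ↔ b ∈ S) :
    S.map (Equiv.swap a b).symm.toEmbedding = S := by
  ext x
  rw [mem_map_equiv, Equiv.symm_symm, Equiv.swap_apply_def]
  split_ifs with h1 h1 <;> simp [h1, h]

/-- A singlet at the positions `a`, `b` is scalar under `(a c) + (b c)`. -/
lemma perm_swap_add_perm_swap {a b c : Fin n} (hab : a ≠ b) (hac : a ≠ c) (hbc : b ≠ c)
    {f : Space n} (hf : perm (Equiv.swap a b) f = -f) :
    perm (Equiv.swap a c) f + perm (Equiv.swap b c) f = f := by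
  have h0 : ∀ S : Finset (Fin n), f (S.map (Equiv.swap a b).symm.toEmbedding) = -f S :=
    fun S => congrFun hf S
  have h1 : ∀ S : Finset (Fin n), (a ∈ S ↔ b ∈ S) → f S = 0 := fun S hS => by
    have := h0 S
    rw [map_swap_of_iff hS] at this
    exact self_eq_neg.1 this
  funext S
  rw [Pi.add_apply, perm_apply, perm_apply]
  -- Among three binary letters two agree. If `c` agrees with `a` or `b`, one transposition fixes
  -- `S` and the other makes the letters at `a` and `b` equal, where `f` vanishes.
  by_cases hca : a ∈ S ↔ c ∈ S
  · rw [map_swap_of_iff hca, h1 (S.map (Equiv.swap b c).symm.toEmbedding), add_zero]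
    simp only [mem_map_equiv, Equiv.symm_symm, Equiv.swap_apply_left,
      Equiv.swap_apply_of_ne_of_ne hab hac]
    exact hca
  by_cases hcb : b ∈ S ↔ c ∈ S
  · rw [map_swap_of_iff hcb, h1 (S.map (Equiv.swap a c).symm.toEmbedding), zero_add]
    simp only [mem_map_equiv, Equiv.symm_symm, Equiv.swap_apply_left,
      Equiv.swap_apply_of_ne_of_ne hab.symm hbc]
    exact hcb.symm
  -- Here `a` and `b` agree, so `f S = 0`, and the two permuted sets differ by the swap of `a` and
  -- `b`, so their values cancel.
  have hS : a ∈ S ↔ b ∈ S := by tauto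
  rw [h1 S hS]
  have h2 : S.map (Equiv.swap a c).symm.toEmbedding
      = (S.map (Equiv.swap b c).symm.toEmbedding).map (Equiv.swap a b).symm.toEmbedding := by
    ext x
    simp only [mem_map_equiv, Equiv.symm_symm]
    rcases eq_or_ne x a with rfl | hxa
    · simp
    rcases eq_or_ne x b with rfl | hxb
    · rw [Equiv.swap_apply_of_ne_of_ne hab.symm hbc, Equiv.swap_apply_right,
        Equiv.swap_apply_of_ne_of_ne hab hac, hS]
    rw [Equiv.swap_apply_of_ne_of_ne (a := a) (b := b) hxa hxb]
    rcases eq_or_ne x c with rfl | hxc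
    · simp [hS]
    rw [Equiv.swap_apply_of_ne_of_ne hxa hxc, Equiv.swap_apply_of_ne_of_ne hxb hxc]
  rw [h2, h0, neg_add_cancel]

lemma pairCoeff_congr {b b' c c' : Prop} [Decidable b] [Decidable b'] [Decidable c] [Decidable c']
    (hb : b ↔ b') (hc : c ↔ c') : pairCoeff b c = pairCoeff b' c' := by
  simp only [pairCoeff, hb, hc]

lemma pairCoeff_swap (b c : Prop) [Decidable b] [Decidable c] :
    pairCoeff c b = -pairCoeff b c := by
  by_cases hb : b <;> by_cases hc : c <;> simp [pairCoeff, hb, hc]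

lemma exists_mem_map_swap {a b : Fin n} (S : Finset (Fin n)) (t : ℕ) :
    (∃ k ∈ S.map (Equiv.swap a b).symm.toEmbedding, k.val + 1 = t)
      ↔ ∃ k ∈ S, (Equiv.swap a b k).val + 1 = t := by
  constructor
  · rintro ⟨k, hk, rfl⟩
    exact ⟨Equiv.swap a b k, by simpa using hk, by simp⟩
  · rintro ⟨k, hk, rfl⟩
    exact ⟨Equiv.swap a b k, by simpa using hk, rfl⟩

lemma exists_mem_map_swap_of_ne {a b : Fin n} (S : Finset (Fin n)) {t : ℕ} (ha : a.val + 1 ≠ t)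
    (hb : b.val + 1 ≠ t) :
    (∃ k ∈ S.map (Equiv.swap a b).symm.toEmbedding, k.val + 1 = t) ↔ ∃ k ∈ S, k.val + 1 = t := by
  rw [exists_mem_map_swap]
  refine exists_congr fun k => and_congr_right fun _ => ?_
  rw [Equiv.swap_apply_def]
  split_ifs with h h
  · subst h; tauto
  · subst h; tauto
  · rfl

lemma exists_mem_map_swap_left {a b : Fin n} (S : Finset (Fin n)) {t u : ℕ} (ha : a.val + 1 = t)
    (hb : b.val + 1 = u) :
    (∃ k ∈ S.map (Equiv.swap a b).symm.toEmbedding, k.val + 1 = t) ↔ ∃ k ∈ S, k.val + 1 = u := by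
  rw [exists_mem_map_swap]
  refine exists_congr fun k => and_congr_right fun _ => ?_
  rw [Equiv.swap_apply_def]
  split_ifs with h h'
  · subst h; omega
  · subst h'; omega
  · rw [Fin.ext_iff] at h h'
    omega

lemma card_filter_map_swap {a b : Fin n} (S : Finset (Fin n)) {m : ℕ}
    (hab : 2 * m < a.val + 1 ↔ 2 * m < b.val + 1) :
    ((S.map (Equiv.swap a b).symm.toEmbedding).filter fun k => 2 * m < k.val + 1).card
      = (S.filter fun k => 2 * m < k.val + 1).card := by
  rw [filter_map, card_map]
  congr 1
  refine filter_congr fun k _ => ?_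
  simp only [Function.comp_apply, Equiv.coe_toEmbedding, Equiv.symm_swap]
  rw [Equiv.swap_apply_def]
  split_ifs with h h
  · subst h; exact hab.symm
  · subst h; exact hab
  · rfl

lemma perm_swap_gColumn_of_le {m i : ℕ} {a b : Fin n} (ha : 2 * m ≤ a.val) (hb : 2 * m ≤ b.val) :
    perm (Equiv.swap a b) (gColumn n m i) = gColumn n m i := by
  funext S
  rw [perm_apply, gColumn, gColumn, card_filter_map_swap S (by omega)]
  congr 1
  refine prod_congr rfl fun r hr => ?_
  have := mem_Icc.1 hr
  exact pairCoeff_congr (exists_mem_map_swap_of_ne S (by omega) (by omega))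
    (exists_mem_map_swap_of_ne S (by omega) (by omega))

lemma perm_swap_gColumn_pair {m i t : ℕ} {a b : Fin n} (ht : t < m) (ha : a.val = 2 * t)
    (hb : b.val = 2 * t + 1) :
    perm (Equiv.swap a b) (gColumn n m i) = -gColumn n m i := by
  funext S
  rw [perm_apply, Pi.neg_apply, gColumn, gColumn, card_filter_map_swap S (by omega), ← neg_mul]
  congr 1
  have htm : t + 1 ∈ Icc 1 m := mem_Icc.2 ⟨by omega, ht⟩
  rw [← mul_prod_erase _ _ htm, ← mul_prod_erase _ _ htm, ← neg_mul]
  congr 1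
  · rw [← pairCoeff_swap]
    refine pairCoeff_congr (exists_mem_map_swap_left S (by omega) (by omega)) ?_
    rw [Equiv.swap_comm]
    exact exists_mem_map_swap_left S (by omega) (by omega)
  · refine prod_congr rfl fun r hr => ?_
    obtain ⟨h1, h2⟩ := mem_erase.1 hr
    have := mem_Icc.1 h2
    exact pairCoeff_congr (exists_mem_map_swap_of_ne S (by omega) (by omega))
      (exists_mem_map_swap_of_ne S (by omega) (by omega))

/-- The content of the box with entry `x` in the tableau with two rows whose first `m` columns are
filled column by column. -/
def columnContent (m x : ℕ) : ℤ :=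
  if x ≤ 2 * m then if x % 2 = 1 then x / 2 else x / 2 - 2 else x - m - 1

/-- The transposition of `i` and `r`, or `0` if `i` is out of range. -/
def swapAt (r : Fin n) (i : ℕ) : Module.End ℂ (Space n) :=
  if h : i < n then perm (Equiv.swap ⟨i, h⟩ r) else 0

lemma jucysMurphy_eq_sum_range (r : Fin n) : jucysMurphy r = ∑ i ∈ range r.val, swapAt r i := by
  rw [jucysMurphy]
  refine sum_bij (fun i _ => i.val) (fun i hi => ?_) (fun i _ k _ h => Fin.ext h) (fun i hi => ?_)
    fun i _ => ?_
  · exact mem_range.2 (Fin.lt_def.1 (mem_Iio.1 hi))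
  · have := mem_range.1 hi
    exact ⟨⟨i, by omega⟩, mem_Iio.2 (Fin.lt_def.2 this), rfl⟩
  · rw [swapAt, dif_pos i.isLt]

lemma sum_swapAt_pairs (m i : ℕ) (r : Fin n) : ∀ t ≤ m, 2 * t ≤ r.val →
    ∑ k ∈ range (2 * t), swapAt r k (gColumn n m i) = (t : ℂ) • gColumn n m i := by
  intro t
  induction t with
  | zero => simp
  | succ t ih =>
    intro htm htr
    have hr := r.isLt
    have e : 2 * (t + 1) = 2 * t + 1 + 1 := by ring
    rw [e, sum_range_succ, sum_range_succ, ih (by omega) (by omega), swapAt, swapAt,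
      dif_pos (by omega), dif_pos (by omega), add_assoc, perm_swap_add_perm_swap]
    · push_cast
      rw [add_smul, one_smul]
    · simp
    · rw [Ne, Fin.ext_iff]; simp only; omega
    · rw [Ne, Fin.ext_iff]; simp only; omega
    · exact perm_swap_gColumn_pair (t := t) (by omega) rfl rfl

/-- Each complete singlet before position `r` contributes `1`, the partner of `r` in its own singlet
`-1`, and each earlier position of the symmetric tail `1`. -/
lemma hasContents_gColumn (m i : ℕ) : HasContents (gColumn n m i) (columnContent m) := by
  intro r
  have hr := r.isLt
  rw [jucysMurphy_eq_sum_range, LinearMap.sum_apply]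
  rcases lt_or_ge r.val (2 * m) with h | h
  · obtain ⟨t, ht⟩ := Nat.even_or_odd' r.val
    rcases ht with ht | ht
    · have e : columnContent m (r.val + 1) = t := by
        rw [columnContent, if_pos (by omega), if_pos (by omega)]
        omega
      rw [e, ht, sum_swapAt_pairs m i r t (by omega) (by omega), Int.cast_natCast]
    · have e : columnContent m (r.val + 1) = t - 1 := by
        rw [columnContent, if_pos (by omega), if_neg (by omega)]
        omega
      rw [e, ht, sum_range_succ, sum_swapAt_pairs m i r t (by omega) (by omega), swapAt,
        dif_pos (by omega), perm_swap_gColumn_pair (t := t) (by omega) rfl ht]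
      push_cast
      rw [sub_smul, one_smul, sub_eq_add_neg]
  · obtain ⟨j, hj⟩ := Nat.exists_eq_add_of_le h
    have e : columnContent m (r.val + 1) = m + j := by
      rw [columnContent, if_neg (by omega)]
      push_cast
      omega
    rw [e, hj, sum_range_add, sum_swapAt_pairs m i r m le_rfl h,
      sum_congr rfl (g := fun _ => gColumn n m i)]
    · rw [sum_const, card_range]
      push_cast
      rw [add_smul, Nat.cast_smul_eq_nsmul ℂ j]
    · intro k hk
      have := mem_range.1 hk
      rw [swapAt, dif_pos (by omega), perm_swap_gColumn_of_le (by simp) h]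

lemma hasContents_fColumn (m ℓ : ℕ) : HasContents (fColumn n m ℓ) (columnContent m) :=
  HasContents.sum fun i _ => (hasContents_gColumn m i).smul _

end Column

/-! ### The squared norm of the column vector. -/

section ColumnNorm

lemma pairCoeff_sq (b c : Prop) [Decidable b] [Decidable c] :
    pairCoeff b c ^ 2 = if (b ↔ c) then 0 else 1 := by
  by_cases hb : b <;> by_cases hc : c <;> simp [pairCoeff, hb, hc]

/-- Only sets containing exactly one element of each pair contribute, which gives `2 ^ m` choices
and `m` extra elements. `F` takes two sizes because `scalarT` sees the tail only, while the weight
sees the whole set. -/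
lemma sum_powerset_pairs (m : ℕ) : ∀ (U : Finset ℕ) (F : ℕ → ℕ → ℂ), Disjoint (range (2 * m)) U →
    ∑ S ∈ (range (2 * m) ∪ U).powerset,
        (∏ r ∈ range m, pairCoeff (2 * r ∈ S) (2 * r + 1 ∈ S) ^ 2) * F (S ∩ U).card S.card
      = 2 ^ m * ∑ S ∈ U.powerset, F S.card (S.card + m) := by
  induction m with
  | zero =>
    intro U F _
    simp only [mul_zero, range_zero, empty_union, prod_empty, one_mul, pow_zero, add_zero]
    exact sum_congr rfl fun S hS => by rw [inter_eq_left.2 (mem_powerset.1 hS)]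
  | succ m ih =>
    intro U F hU
    have hU' : ∀ x ∈ U, 2 * m + 2 ≤ x := fun x hx => by
      by_contra h
      exact disjoint_left.1 hU (mem_range.2 (show x < 2 * (m + 1) by omega)) hx
    have hd : Disjoint (range (2 * m)) U := by
      rw [disjoint_left]
      intro x hx hxU
      have := hU' x hxU
      have := mem_range.1 hx
      omega
    have e : range (2 * (m + 1)) ∪ U
        = insert (2 * m + 1) (insert (2 * m) (range (2 * m) ∪ U)) := by
      ext x
      by_cases hx : x ∈ U
      · simp only [mem_union, mem_insert, hx, or_true]
      · simp only [mem_union, mem_range, mem_insert, hx, or_false]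
        omega
    have h0 : 2 * m ∉ range (2 * m) ∪ U := fun h => by
      rcases mem_union.1 h with h | h
      · exact absurd (mem_range.1 h) (lt_irrefl _)
      · have := hU' _ h
        omega
    have h1' : 2 * m + 1 ∉ range (2 * m) ∪ U := fun h => by
      rcases mem_union.1 h with h | h
      · have := mem_range.1 h
        omega
      · have := hU' _ h
        omega
    have h1 : 2 * m + 1 ∉ insert (2 * m) (range (2 * m) ∪ U) := by
      rw [mem_insert, not_or]
      exact ⟨by omega, h1'⟩
    have h0U : 2 * m ∉ U := fun h => h0 (mem_union_right _ h)
    have h1U : 2 * m + 1 ∉ U := fun h => h1' (mem_union_right _ h)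
    rw [e, sum_powerset_insert h1, sum_powerset_insert h0, sum_powerset_insert h0]
    have key : ∀ (p : ℕ), p = 2 * m ∨ p = 2 * m + 1 → ∀ S ∈ (range (2 * m) ∪ U).powerset,
        (∏ r ∈ range (m + 1), pairCoeff (2 * r ∈ insert p S) (2 * r + 1 ∈ insert p S) ^ 2)
          * F (insert p S ∩ U).card (insert p S).card
        = (∏ r ∈ range m, pairCoeff (2 * r ∈ S) (2 * r + 1 ∈ S) ^ 2)
          * F (S ∩ U).card (S.card + 1) := by
      intro p hp S hS
      have hS := mem_powerset.1 hS
      have s0 : 2 * m ∉ S := fun h => h0 (hS h)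
      have s1 : 2 * m + 1 ∉ S := fun h => h1' (hS h)
      have hpS : p ∉ S := by rcases hp with rfl | rfl <;> assumption
      have hpU : p ∉ U := by rcases hp with rfl | rfl <;> assumption
      rw [prod_range_succ, insert_inter_of_notMem hpU, card_insert_of_notMem hpS]
      have e1 : pairCoeff (2 * m ∈ insert p S) (2 * m + 1 ∈ insert p S) ^ 2 = 1 := by
        rw [pairCoeff_sq, if_neg]
        rcases hp with rfl | rfl <;> simp [s0, s1]
      rw [e1, mul_one]
      congr 1
      refine prod_congr rfl fun r hr => ?_
      have := mem_range.1 hr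
      congr 1
      refine pairCoeff_congr ?_ ?_ <;>
      · rw [mem_insert]
        exact or_iff_right (by omega)
    have z0 : ∀ S ∈ (range (2 * m) ∪ U).powerset,
        (∏ r ∈ range (m + 1), pairCoeff (2 * r ∈ S) (2 * r + 1 ∈ S) ^ 2)
          * F (S ∩ U).card S.card = 0 := by
      intro S hS
      have hS := mem_powerset.1 hS
      have s0 : 2 * m ∉ S := fun h => h0 (hS h)
      have s1 : 2 * m + 1 ∉ S := fun h => h1' (hS h)
      rw [prod_range_succ, pairCoeff_sq, if_pos (by simp [s0, s1]), mul_zero, zero_mul]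
    have z1 : ∀ S ∈ (range (2 * m) ∪ U).powerset,
        (∏ r ∈ range (m + 1), pairCoeff (2 * r ∈ insert (2 * m + 1) (insert (2 * m) S))
            (2 * r + 1 ∈ insert (2 * m + 1) (insert (2 * m) S)) ^ 2)
          * F (insert (2 * m + 1) (insert (2 * m) S) ∩ U).card
            (insert (2 * m + 1) (insert (2 * m) S)).card = 0 := by
      intro S _
      rw [prod_range_succ, pairCoeff_sq, if_pos (by simp), mul_zero, zero_mul]
    rw [sum_eq_zero z0, sum_eq_zero z1, sum_congr rfl (key _ (Or.inl rfl)),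
      sum_congr rfl (key _ (Or.inr rfl)), ih U (fun a b => F a (b + 1)) hd]
    simp only [add_assoc]
    ring

variable {n : ℕ}

lemma sum_univ_finset_fin (G : Finset ℕ → ℂ) :
    ∑ S : Finset (Fin n), G (S.map Fin.valEmbedding) = ∑ S ∈ (range n).powerset, G S := by
  refine sum_bij (fun S _ => S.map Fin.valEmbedding) (fun S _ => ?_)
    (fun S _ T _ h => map_injective _ h) (fun S hS => ?_) fun S _ => rfl
  · rw [mem_powerset]
    intro x hx
    obtain ⟨k, _, rfl⟩ := mem_map.1 hx
    exact mem_range.2 k.isLt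
  · refine ⟨S.attachFin fun k hk => mem_range.1 (mem_powerset.1 hS hk), mem_univ _, ?_⟩
    ext x
    simp only [mem_map, mem_attachFin, Fin.valEmbedding_apply]
    constructor
    · rintro ⟨k, hk, rfl⟩
      exact hk
    · intro hx
      exact ⟨⟨x, mem_range.1 (mem_powerset.1 hS hx)⟩, hx, rfl⟩

lemma card_filter_eq {m : ℕ} (S : Finset (Fin n)) :
    (S.filter fun k => 2 * m < k.val + 1).card
      = (S.map Fin.valEmbedding ∩ Ico (2 * m) n).card := by
  rw [← card_map Fin.valEmbedding]
  congr 1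
  ext x
  simp only [mem_map, mem_filter, mem_inter, mem_Ico, Fin.valEmbedding_apply]
  constructor
  · rintro ⟨k, ⟨hk, h⟩, rfl⟩
    exact ⟨⟨k, hk, rfl⟩, by omega, k.isLt⟩
  · rintro ⟨⟨k, hk, rfl⟩, h, _⟩
    exact ⟨k, ⟨hk, by omega⟩, rfl⟩

lemma fColumn_apply (m ℓ : ℕ) (S : Finset (Fin n)) :
    fColumn n m ℓ S
      = (∏ r ∈ range m, pairCoeff (2 * r ∈ S.map Fin.valEmbedding)
          (2 * r + 1 ∈ S.map Fin.valEmbedding))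
        * scalarT m n ℓ (S.map Fin.valEmbedding ∩ Ico (2 * m) n).card := by
  have hP : (∏ r ∈ Icc 1 m, pairCoeff (∃ k ∈ S, k.val + 1 = 2 * r - 1) (∃ k ∈ S, k.val + 1 = 2 * r))
      = ∏ r ∈ range m, pairCoeff (2 * r ∈ S.map Fin.valEmbedding)
          (2 * r + 1 ∈ S.map Fin.valEmbedding) := by
    refine prod_nbij' (· - 1) (· + 1) (fun r hr => ?_) (fun r hr => ?_) (fun r hr => ?_)
      (fun r _ => Nat.add_sub_cancel r 1) fun r hr => ?_
    · have := mem_Icc.1 hr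
      exact mem_range.2 (by omega)
    · have := mem_range.1 hr
      exact mem_Icc.2 (by omega)
    · exact Nat.sub_add_cancel (mem_Icc.1 hr).1
    have := mem_Icc.1 hr
    refine pairCoeff_congr ?_ ?_ <;>
    · simp only [mem_map, Fin.valEmbedding_apply]
      refine exists_congr fun k => and_congr_right fun _ => ?_
      omega
  have hle : (S.map Fin.valEmbedding ∩ Ico (2 * m) n).card < n - 2 * m + 1 := by
    refine Nat.lt_succ_of_le ((card_le_card inter_subset_right).trans ?_)
    rw [Nat.card_Ico]
  simp only [fColumn, Finset.sum_apply, Pi.smul_apply, smul_eq_mul, gColumn, hP, card_filter_eq,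
    mul_ite, mul_one, mul_zero]
  rw [sum_ite_eq, if_pos (mem_range.2 hle), mul_comm]

lemma innerPi_fColumn {m ℓ : ℕ} (hm : 2 * m ≤ n) (hℓ : ℓ ≤ n - 2 * m) :
    innerPi (fColumn n m ℓ) (fColumn n m ℓ)
      = 2 ^ m / (n + 1)
        * ((2 * m + ℓ).factorial / ((2 * m + 2 * ℓ + 1) * (m + ℓ).factorial ^ 2 * ℓ.factorial))
        * ((n - 2 * m).factorial / n.factorial)
        * ((n + ℓ + 1).factorial / (n - 2 * m - ℓ).factorial) := by
  have h1 : innerPi (fColumn n m ℓ) (fColumn n m ℓ)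
      = ∑ S ∈ (range n).powerset, (∏ r ∈ range m, pairCoeff (2 * r ∈ S) (2 * r + 1 ∈ S) ^ 2)
        * (fun a b : ℕ => scalarT m n ℓ a ^ 2 / ((n + 1) * n.choose b))
          (S ∩ Ico (2 * m) n).card S.card := by
    rw [← sum_univ_finset_fin]
    refine sum_congr rfl fun S _ => ?_
    have hc : ∀ b c : Prop, ∀ [Decidable b] [Decidable c],
        starRingEnd ℂ (pairCoeff b c) = pairCoeff b c := by
      intro b c _ _
      by_cases hb : b <;> by_cases hc : c <;> simp [pairCoeff, hb, hc]
    rw [fColumn_apply, map_mul, map_prod, scalarT_conj, card_map, prod_pow]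
    simp only [hc]
    ring
  have h2 : range n = range (2 * m) ∪ Ico (2 * m) n := by
    ext x
    simp only [mem_union, mem_range, mem_Ico]
    omega
  have hd : Disjoint (range (2 * m)) (Ico (2 * m) n) := by
    rw [disjoint_left]
    intro x
    simp only [mem_range, mem_Ico]
    omega
  -- Grouping the tail subsets by size produces the factor `(n - 2m).choose i` of the Hahn weight.
  rw [h1, h2, sum_powerset_pairs m _ (fun a b => scalarT m n ℓ a ^ 2 / ((n + 1) * n.choose b)) hd,
    sum_powerset_apply_card fun a => scalarT m n ℓ a ^ 2 / ((n + 1) * n.choose (a + m)),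
    Nat.card_Ico]
  obtain ⟨N, rfl⟩ := Nat.exists_eq_add_of_le' hm
  rw [Nat.add_sub_cancel] at *
  rw [mul_assoc, mul_assoc, div_mul_eq_mul_div, ← mul_div, ← mul_assoc (_ / _), ← sum_hahnPoly_sq hℓ]
  congr 1
  rw [sum_div]
  refine sum_congr rfl fun i hi => ?_
  have := mem_range.1 hi
  rw [scalarT_eq (by omega), Nat.add_sub_cancel, nsmul_eq_mul, add_comm i m,
    div_mul_eq_div_div]
  ring

end ColumnNorm

/-! ### Two-row tableaux and the product `τ_Q`. -/

section Tableau
variable {n m : ℕ} {h : 2 * m ≤ n}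

lemma mem_shape {c : ℕ × ℕ} :
    c ∈ shape n m h ↔ c.1 = 0 ∧ c.2 < n - m ∨ c.1 = 1 ∧ c.2 < m := by
  obtain ⟨i, j⟩ := c
  rw [shape, YoungDiagram.mem_ofRowLens]
  match i with
  | 0 => simp
  | 1 => simp
  | i + 2 => simp

lemma card_shape : (shape n m h).card = n := by
  have e : (shape n m h).cells
      = (range (n - m)).image (Prod.mk 0) ∪ (range m).image (Prod.mk 1) := by
    ext ⟨i, j⟩
    rw [YoungDiagram.mem_cells, mem_shape]
    simp only [mem_union, mem_image, mem_range, Prod.mk.injEq]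
    constructor
    · rintro (⟨rfl, hj⟩ | ⟨rfl, hj⟩)
      · exact Or.inl ⟨j, hj, rfl, rfl⟩
      · exact Or.inr ⟨j, hj, rfl, rfl⟩
    · rintro (⟨k, hk, rfl, rfl⟩ | ⟨k, hk, rfl, rfl⟩)
      · exact Or.inl ⟨rfl, hk⟩
      · exact Or.inr ⟨rfl, hk⟩
  rw [YoungDiagram.card, e, card_union_of_disjoint, card_image_of_injective _ (Prod.mk_right_injective _),
    card_image_of_injective _ (Prod.mk_right_injective _), card_range, card_range]
  · omega
  · rw [disjoint_left]
    intro x hx hx'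
    obtain ⟨j, _, rfl⟩ := mem_image.1 hx
    obtain ⟨k, _, hk⟩ := mem_image.1 hx'
    simp at hk

variable (Q : StandardYoungTableau (shape n m h))

lemma a_le {r : ℕ} (hr : 1 ≤ r) (hrm : r ≤ m) : Q.a r ≤ n := by
  have hc : (1, r - 1) ∈ shape n m h := mem_shape.2 (Or.inr ⟨rfl, by simp; omega⟩)
  have := (Q.bijOn.mapsTo (mem_coe.2 ((YoungDiagram.mem_cells _).2 hc))).2
  rwa [card_shape] at this

lemma a_lt_a_succ {r : ℕ} (hr : 1 ≤ r) (hrm : r < m) : Q.a r < Q.a (r + 1) := by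
  have hc : (1, r - 1) ∈ shape n m h := mem_shape.2 (Or.inr ⟨rfl, by simp; omega⟩)
  have hc' : (1, r) ∈ shape n m h := mem_shape.2 (Or.inr ⟨rfl, hrm⟩)
  refine lt_of_le_of_ne (Q.row_weak' (by omega) hc') fun he => ?_
  have := Q.bijOn.injOn (mem_coe.2 ((YoungDiagram.mem_cells _).2 hc))
    (mem_coe.2 ((YoungDiagram.mem_cells _).2 hc')) he
  have := (Prod.ext_iff.1 this).2
  simp only at this
  omega

/-- The first `r` columns hold `2r` distinct positive entries, all at most `a_r`. -/
lemma two_mul_le_a {r : ℕ} (hr : 1 ≤ r) (hrm : r ≤ m) : 2 * r ≤ Q.a r := by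
  have hsub : ∀ c ∈ range 2 ×ˢ range r, c ∈ shape n m h := by
    rintro ⟨i, j⟩ hc
    have := mem_product.1 hc
    simp only [mem_range] at this
    rw [mem_shape]
    simp only
    omega
  have hmaps : ∀ c ∈ range 2 ×ˢ range r, Q.entry c.1 c.2 ∈ Icc 1 (Q.a r) := by
    rintro ⟨i, j⟩ hc
    refine mem_Icc.2 ⟨(Q.bijOn.mapsTo (mem_coe.2 ((YoungDiagram.mem_cells _).2 (hsub _ hc)))).1, ?_⟩
    have hc' := mem_product.1 hc
    simp only [mem_range] at hc'
    have h1 : Q.entry 1 j ≤ Q.a r := by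
      rcases Nat.lt_or_ge j (r - 1) with hj | hj
      · exact Q.row_weak' hj (hsub (1, r - 1) (by simp; omega))
      · rw [show j = r - 1 by omega]
        exact le_rfl
    have h0 : Q.entry 0 j < Q.entry 1 j :=
      Q.col_strict' one_pos (hsub (1, j) (by simp; omega))
    have : i = 0 ∨ i = 1 := by omega
    rcases this with rfl | rfl
    · exact h0.le.trans h1
    · exact h1
  have := card_le_card_of_injOn _ hmaps fun c hc d hd he =>
    Q.bijOn.injOn (mem_coe.2 ((YoungDiagram.mem_cells _).2 (hsub c hc)))
      (mem_coe.2 ((YoungDiagram.mem_cells _).2 (hsub d hd))) he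
  simpa using this

/-- The last `t` factors of `τ_Q` turn the contents of the column reading tableau into those of a
tableau which agrees with it in the first `m - t` columns. -/
lemma exists_hasContents_tauRows {f : Space n} (hf : HasContents f (columnContent m)) (t s : ℕ)
    (hst : s + t = m) :
    ∃ c : ℕ → ℤ,
      HasContents (((List.range' (s + 1) t).map fun r => tauRow n r (Q.a r)).prod f) c
      ∧ (∀ x, 1 ≤ x → x ≤ n → (s < m → x < Q.a (s + 1)) → c x = columnContent s x)
      ∧ innerPi (((List.range' (s + 1) t).map fun r => tauRow n r (Q.a r)).prod f)
          (((List.range' (s + 1) t).map fun r => tauRow n r (Q.a r)).prod f)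
        = (∏ r ∈ Icc (s + 1) m, ∏ k ∈ Icc 2 (Q.a r - 2 * r + 1), ((k : ℂ) ^ 2 - 1) / (k : ℂ) ^ 2)
          * innerPi f f := by
  induction t generalizing s with
  | zero =>
    obtain rfl : s = m := by omega
    exact ⟨columnContent s, by simpa using hf, fun _ _ _ _ => rfl, by simp⟩
  | succ t ih =>
    obtain ⟨c, h1, h2, h3⟩ := ih (s + 1) (by omega)
    have e : ((List.range' (s + 1) (t + 1)).map fun r => tauRow n r (Q.a r)).prod f
        = tauRow n (s + 1) (Q.a (s + 1))
          (((List.range' (s + 1 + 1) t).map fun r => tauRow n r (Q.a r)).prod f) := by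
      rw [List.range'_succ]
      simp
    have ha := two_mul_le_a Q (r := s + 1) (by omega) (by omega)
    have ha' := a_le Q (r := s + 1) (by omega) (by omega)
    have hlt : s + 1 < m → Q.a (s + 1) < Q.a (s + 1 + 1) := a_lt_a_succ Q (by omega)
    -- The entry `2(s + 1)` is the second-row box of column `s + 1`, with content `s - 1`; the later
    -- entries below the next `a` continue the first row from content `s + 1`. The gap therefore
    -- starts at `2`.
    have hp : c (2 * (s + 1)) = s - 1 := by
      rw [h2 _ (by omega) (by omega) fun h => by have := hlt h; omega, columnContent,
        if_pos (by omega), if_neg (by omega)]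
      omega
    have hq : ∀ i < Q.a (s + 1) - 2 * (s + 1), c (2 * (s + 1) + i + 1) = s + 1 + i := by
      intro i hi
      rw [h2 _ (by omega) (by omega) fun h => by have := hlt h; omega, columnContent,
        if_neg (by omega)]
      push_cast
      ring
    obtain ⟨c', g1, g2, g3, -, -, g6⟩ := h1.tau_prod (p := 2 * (s + 1)) (by omega)
      (Q.a (s + 1) - 2 * (s + 1)) (by omega) fun i hi => by
        rw [hq i hi, hp]
        ring
    rw [e]
    refine ⟨c', g1, fun x hx hxn hxa => ?_, ?_⟩
    -- Once that box has moved to `a_{s+1}`, the first-row boxes it passed have shifted down by one,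
    -- so below `a_{s+1}` only `s` filled columns and a first row remain.
    · have hxa := hxa (by omega)
      rcases lt_or_ge x (2 * (s + 1)) with hx2 | hx2
      · rw [g2 x hx2, h2 x hx hxn fun h => by have := hlt h; omega, columnContent, columnContent]
        split_ifs <;> push_cast <;> omega
      · obtain ⟨i, rfl⟩ := Nat.exists_eq_add_of_le hx2
        rw [g3 i (by omega), hq i (by omega), columnContent, if_neg (by omega)]
        push_cast
        ring
    · rw [← mul_prod_Ioc_eq_prod_Icc (show s + 1 ≤ m by omega), mul_assoc]
      refine g6.trans ?_
      rw [h3]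
      congr 2
      refine prod_congr ?_ fun _ _ => rfl
      ext
      simp only [mem_Icc, mem_Ioc]
      omega

end Tableau
end TwoRowBasis

theorem corollary5p5 (n m ℓ : ℕ) (hm : 2 * m ≤ n) (hℓ : ℓ ≤ n - 2 * m)
    (Q : TwoRowBasis.StandardYoungTableau (TwoRowBasis.shape n m hm)) :
    TwoRowBasis.innerPi (TwoRowBasis.fTableau Q ℓ) (TwoRowBasis.fTableau Q ℓ) =
      ((TwoRowBasis.gammaTableau Q
        * ((2 : ℝ) ^ m / ((n : ℝ) + 1))
        * (((2 * m + ℓ).factorial : ℝ)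
            / ((2 * (m : ℝ) + 2 * (ℓ : ℝ) + 1) * ((m + ℓ).factorial : ℝ) ^ 2
                * (ℓ.factorial : ℝ)))
        * (((n - 2 * m).factorial : ℝ) / (n.factorial : ℝ))
        * (((n + ℓ + 1).factorial : ℝ) / ((n - 2 * m - ℓ).factorial : ℝ)) : ℝ) : ℂ) := by
  obtain ⟨c, -, -, h⟩ := TwoRowBasis.exists_hasContents_tauRows Q
    (TwoRowBasis.hasContents_fColumn m ℓ) m 0 (zero_add m)
  refine h.trans ?_
  rw [TwoRowBasis.innerPi_fColumn hm hℓ, TwoRowBasis.gammaTableau]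
  push_cast
  ring
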